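/- Let $A$ be a real $m\times n$ matrix with $\operatorname{rank}(A)=n$, and let $\kappa_2(A)=\|A\|_2\|A^\dagger\|_2$, where $A^\dagger$ is the Moore–Penrose inverse. Consider component-wise row-scaled perturbations $\Delta A\in\mathbb{R}^{m\times n}$, that is, $$e_j^T\Delta A=\zeta_j\,\eta_j\,e_j^TA,\qquad |\zeta_j|\le 1,\quad \eta_j\ge 0,\quad 1\le j\le m,\qquad \eta=\max_{1\le j\le m}\eta_j .$$ Let $\ell_j=\|e_j^TQ\|_2^2$ be the leverage scores of $A$, where $Q$ is any $m\times n$ matrix whose columns form an orthonormal basis of $\operatorname{range}(A)$. If $\eta\,\kappa_2(A)<1$, then $\operatorname{rank}(A+\Delta A)=n$, and the leverage scores $\tilde\ell_j=\|e_j^T\tilde Q\|_2^2$ computed from any thin QR decomposition $A+\Delta A=\tilde Q\tilde R$ (where $\tilde Q$ is $m\times n$ with orthonormal columns and $\tilde R$ is upper triangular) satisfy $$\frac{|\tilde\ell_j-\ell_j|}{\ell_j}\le 2\left(\eta_j+\sqrt2\,n\,\eta\right)+\mathcal{O}(\eta^2)\qquad\text{for all } 1\le j\le m \text{ with } \ell_j>0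 .$$ Here $\mathcal{O}(\eta^2)$ has the following meaning. For each $A$ the remainder is at most $C\eta^2$ for all such perturbations with $\eta\,\kappa_2(A)<1$ and all such $j$, where the constant $C$ depends only on $A$. Moreover, there are absolute constants $K$ and $\delta>0$ (independent of $m$, $n$, $A$, $\kappa_2(A)$ and the leverage scores) such that the remainder is at most $K\eta^2$ whenever, in addition, $\eta\le\delta$. In particular, to first order the bound depends neither on the condition number of $A$ nor on the size of the leverage score. -/

import Mathlib

open scoped Matrix

/-- The matrix two-norm: the operator norm induced by the Euclidean vector norms. -/
noncomputable def matrixTwoNorm {m n : ℕ} (A : Matrix (Fin m) (Fin n) ℝ) : ℝ :=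
  ‖(Matrix.toEuclideanLin A).toContinuousLinearMap‖

/-- The four Penrose equations: `X` is the Moore-Penrose inverse of the real matrix `A`. -/
structure IsMoorePenroseInverse {m n : ℕ} (A : Matrix (Fin m) (Fin n) ℝ)
    (X : Matrix (Fin n) (Fin m) ℝ) : Prop where
  mul_mul_left : A * X * A = A
  mul_mul_right : X * A * X = X
  symm_left : (A * X)ᵀ = A * X
  symm_right : (X * A)ᵀ = X * A

/-- The Moore-Penrose inverse of a real matrix of full column rank (see
`isMoorePenroseInverse_pinvFullRank` and `IsMoorePenroseInverse.unique`). It is used only for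
matrices of full column rank. -/
noncomputable def pinvFullRank {m n : ℕ} (A : Matrix (Fin m) (Fin n) ℝ) :
    Matrix (Fin n) (Fin m) ℝ :=
  (Aᵀ * A)⁻¹ * Aᵀ

theorem isMoorePenroseInverse_pinvFullRank {m n : ℕ} (A : Matrix (Fin m) (Fin n) ℝ)
    (hA : A.rank = n) : IsMoorePenroseInverse A (pinvFullRank A) := by
  have hu : IsUnit (Aᵀ * A) := by
    have hr : (Aᵀ * A).rank = n := by rw [Matrix.rank_transpose_mul_self, hA]
    rw [← Matrix.mulVec_surjective_iff_isUnit]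
    have ht : LinearMap.range (Aᵀ * A).mulVecLin = ⊤ :=
      Submodule.eq_top_of_finrank_eq (by rw [← Matrix.rank, hr]; simp)
    exact LinearMap.range_eq_top.1 ht
  have hX : pinvFullRank A * A = 1 := by
    rw [pinvFullRank, Matrix.mul_assoc, Matrix.nonsing_inv_mul _ ((Matrix.isUnit_iff_isUnit_det _).1 hu)]
  refine ⟨by rw [Matrix.mul_assoc, hX, Matrix.mul_one], by rw [hX, Matrix.one_mul], ?_,
    by rw [hX, Matrix.transpose_one]⟩
  simp [pinvFullRank, Matrix.transpose_mul, Matrix.transpose_nonsing_inv, Matrix.mul_assoc]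

theorem IsMoorePenroseInverse.unique {m n : ℕ} {A : Matrix (Fin m) (Fin n) ℝ}
    {X Y : Matrix (Fin n) (Fin m) ℝ} (hX : IsMoorePenroseInverse A X)
    (hY : IsMoorePenroseInverse A Y) : X = Y := by
  have h1 : A * X = A * Y := by
    calc A * X = (A * X)ᵀ := hX.symm_left.symm
      _ = ((A * Y) * (A * X))ᵀ := by rw [← Matrix.mul_assoc, hY.mul_mul_left]
      _ = (A * X) * (A * Y) := by rw [Matrix.transpose_mul, hX.symm_left, hY.symm_left]
      _ = A * Y := by rw [← Matrix.mul_assoc, hX.mul_mul_left]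
  have h2 : X * A = Y * A := by
    calc X * A = (X * A)ᵀ := hX.symm_right.symm
      _ = ((X * A) * (Y * A))ᵀ := by
        rw [Matrix.mul_assoc, ← Matrix.mul_assoc A Y A, hY.mul_mul_left]
      _ = (Y * A) * (X * A) := by rw [Matrix.transpose_mul, hX.symm_right, hY.symm_right]
      _ = Y * A := by rw [Matrix.mul_assoc, ← Matrix.mul_assoc A X A, hX.mul_mul_left]
  calc X = X * A * X := hX.mul_mul_right.symm
    _ = Y * A * Y := by rw [h2, Matrix.mul_assoc, h1, ← Matrix.mul_assoc]
    _ = Y := hY.mul_mul_right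

/-- The two-norm condition number with respect to left inversion, `‖A‖₂ ‖A†‖₂`, of a matrix of
full column rank. -/
noncomputable def condTwo {m n : ℕ} (A : Matrix (Fin m) (Fin n) ℝ) : ℝ :=
  matrixTwoNorm A * matrixTwoNorm (pinvFullRank A)

/-- The columns of `Q` form an orthonormal basis of the column space of `A`. -/
def IsOrthonormalBasisOfRange {m n : ℕ} (A Q : Matrix (Fin m) (Fin n) ℝ) : Prop :=
  Qᵀ * Q = 1 ∧ LinearMap.range Q.mulVecLin = LinearMap.range A.mulVecLin

/-- `B = Q * R` is a thin QR decomposition: `Q` has orthonormal columns and the square matrix `R`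
is upper triangular. -/
def IsThinQR {m n : ℕ} (B Q : Matrix (Fin m) (Fin n) ℝ) (R : Matrix (Fin n) (Fin n) ℝ) : Prop :=
  Qᵀ * Q = 1 ∧ (∀ i k : Fin n, k < i → R i k = 0) ∧ B = Q * R

/-- The squared Euclidean norm of the `j`-th row of `Q`. When the columns of `Q` form an orthonormal
basis of the column space of `A`, this is the `j`-th leverage score of `A`. -/
noncomputable def rowLeverage {m n : ℕ} (Q : Matrix (Fin m) (Fin n) ℝ) (j : Fin m) : ℝ :=
  ‖(WithLp.toLp 2 (Q.row j) : EuclideanSpace ℝ (Fin n))‖ ^ 2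

/-- `E` is a component-wise row-scaled perturbation of `A` with row scales `s j ≥ 0` and multipliers
`ζ j ∈ [-1, 1]`: row `j` of `E` is `ζ j * s j` times row `j` of `A`. -/
def IsRowScaledPerturbation {m n : ℕ} (A E : Matrix (Fin m) (Fin n) ℝ) (s ζ : Fin m → ℝ) : Prop :=
  ∀ j : Fin m, 0 ≤ s j ∧ |ζ j| ≤ 1 ∧ E.row j = (ζ j * s j) • A.row j

/-! With `a` the `j`-th row of `A`, the leverage score is `aᵀ(AᵀA)⁻¹a`
(`rowLeverage_eq_invGramForm`). The perturbed matrix is `D * A` with `D` diagonal and entries `1 + d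
j`, `|d j| ≤ η`. Hence its Gram form lies between `(1 - η)²` and `(1 + η)²` times that of `A`, and
inversion reverses the order (`invGramForm_le_mul`). The ratio of new to old score therefore lies
between `(1 + d j)² / (1 + η)²` and `(1 + d j)² / (1 - η)²`. This gives `2 (s j + η) + O(η²)`,
sharper than required since `√2 n ≥ 1`. The condition number serves only to force `η < 1`. -/

theorem gram_isUnit_of_rank {m n : ℕ} {A : Matrix (Fin m) (Fin n) ℝ} (hA : A.rank = n) :
    IsUnit (Aᵀ * A).det := by
  have hr : (Aᵀ * A).rank = n := by rw [Matrix.rank_transpose_mul_self, hA]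
  rw [← Matrix.isUnit_iff_isUnit_det, ← Matrix.mulVec_surjective_iff_isUnit]
  have ht : LinearMap.range (Aᵀ * A).mulVecLin = ⊤ :=
    Submodule.eq_top_of_finrank_eq (by rw [← Matrix.rank, hr]; simp)
  exact LinearMap.range_eq_top.1 ht

theorem pinvFullRank_mul_self {m n : ℕ} {A : Matrix (Fin m) (Fin n) ℝ} (hA : A.rank = n) :
    pinvFullRank A * A = 1 := by
  rw [pinvFullRank, Matrix.mul_assoc, Matrix.nonsing_inv_mul _ (gram_isUnit_of_rank hA)]

theorem one_le_condTwo {m n : ℕ} {A : Matrix (Fin m) (Fin n) ℝ} (hA : A.rank = n) (hn : 0 < n) :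
    1 ≤ condTwo A := by
  have : Nonempty (Fin n) := ⟨⟨0, hn⟩⟩
  have h : (Matrix.toEuclideanLin (pinvFullRank A)).toContinuousLinearMap.comp
      (Matrix.toEuclideanLin A).toContinuousLinearMap =
      ContinuousLinearMap.id ℝ (EuclideanSpace ℝ (Fin n)) := by
    ext x i
    simp [Matrix.toLpLin_apply, pinvFullRank_mul_self hA]
  have h1 := ContinuousLinearMap.opNorm_comp_le
    (Matrix.toEuclideanLin (pinvFullRank A)).toContinuousLinearMap
    (Matrix.toEuclideanLin A).toContinuousLinearMap
  rw [h, ContinuousLinearMap.norm_id, mul_comm] at h1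
  exact h1

/-- The quadratic form of the inverse Gram matrix of `A`. -/
noncomputable def invGramForm {m n : ℕ} (A : Matrix (Fin m) (Fin n) ℝ) (a : Fin n → ℝ) : ℝ :=
  a ⬝ᵥ ((Aᵀ * A)⁻¹ *ᵥ a)

theorem invGramForm_smul {m n : ℕ} (A : Matrix (Fin m) (Fin n) ℝ) (c : ℝ) (a : Fin n → ℝ) :
    invGramForm A (c • a) = c ^ 2 * invGramForm A a := by
  simp only [invGramForm, Matrix.mulVec_smul, dotProduct_smul, smul_dotProduct, smul_eq_mul]
  ring

theorem rowLeverage_eq_dotProduct {m n : ℕ} (Q : Matrix (Fin m) (Fin n) ℝ) (j : Fin m) :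
    rowLeverage Q j = Q.row j ⬝ᵥ Q.row j := by
  simp [rowLeverage, EuclideanSpace.real_norm_sq_eq, dotProduct, ← sq]

/-- The factor `R` cancels. It need not be triangular, so both a thin QR factor and an arbitrary
orthonormal basis, with `R = QᵀA`, are covered. -/
theorem rowLeverage_eq_invGramForm {m n : ℕ} {B Q : Matrix (Fin m) (Fin n) ℝ}
    {R : Matrix (Fin n) (Fin n) ℝ} (hB : B.rank = n) (hQ : Qᵀ * Q = 1) (h : B = Q * R)
    (j : Fin m) : rowLeverage Q j = invGramForm B (B.row j) := by
  have hG : Bᵀ * B = Rᵀ * R := by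
    rw [h, Matrix.transpose_mul, Matrix.mul_assoc, ← Matrix.mul_assoc Qᵀ, hQ, Matrix.one_mul]
  have hR : IsUnit R.det := by
    have := gram_isUnit_of_rank hB
    rw [hG, Matrix.det_mul] at this
    exact isUnit_of_mul_isUnit_right this
  have hrow : B.row j = Rᵀ *ᵥ Q.row j := by
    rw [h, Matrix.mulVec_transpose]
    rfl
  rw [rowLeverage_eq_dotProduct, invGramForm, hG, hrow, Matrix.mul_inv_rev, Matrix.mulVec_mulVec,
    Matrix.mul_assoc, Matrix.nonsing_inv_mul _ (by rwa [Matrix.det_transpose]), Matrix.mul_one,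
    Matrix.mulVec_transpose, ← Matrix.dotProduct_mulVec, Matrix.mulVec_mulVec,
    Matrix.mul_nonsing_inv _ hR, Matrix.one_mulVec]

theorem IsOrthonormalBasisOfRange.eq_mul {m n : ℕ} {A Q : Matrix (Fin m) (Fin n) ℝ}
    (h : IsOrthonormalBasisOfRange A Q) : A = Q * (Qᵀ * A) := by
  refine Matrix.ext_of_mulVec_single fun i => ?_
  have hx : A *ᵥ Pi.single i 1 ∈ LinearMap.range Q.mulVecLin := by
    rw [h.2]; exact ⟨_, rfl⟩
  obtain ⟨y, hy⟩ := hx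
  rw [Matrix.mulVecLin_apply] at hy
  rw [← Matrix.mulVec_mulVec, ← Matrix.mulVec_mulVec, ← hy, Matrix.mulVec_mulVec y Qᵀ, h.1,
    Matrix.one_mulVec]

theorem rowLeverage_nonneg {m n : ℕ} (Q : Matrix (Fin m) (Fin n) ℝ) (j : Fin m) :
    0 ≤ rowLeverage Q j := sq_nonneg _

theorem rowLeverage_le_one {m n : ℕ} {Q : Matrix (Fin m) (Fin n) ℝ} (hQ : Qᵀ * Q = 1)
    (j : Fin m) : rowLeverage Q j ≤ 1 := by
  have hp : (Q * Qᵀ) * (Q * Qᵀ) = Q * Qᵀ := by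
    rw [Matrix.mul_assoc, ← Matrix.mul_assoc Qᵀ, hQ, Matrix.one_mul]
  have ht : ∀ k, (Q * Qᵀ) k j = (Q * Qᵀ) j k := fun k => by
    simp [Matrix.mul_apply, mul_comm]
  have hl : rowLeverage Q j = (Q * Qᵀ) j j := rowLeverage_eq_dotProduct Q j
  -- A diagonal entry of a symmetric idempotent is the squared norm of its row.
  have h : (Q * Qᵀ) j j ^ 2 ≤ (Q * Qᵀ) j j := by
    conv_rhs => rw [← hp, Matrix.mul_apply]
    simp only [ht, ← sq]
    exact Finset.single_le_sum (f := fun k => (Q * Qᵀ) j k ^ 2) (fun _ _ => sq_nonneg _)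
      (Finset.mem_univ j)
  rw [hl]
  nlinarith

theorem mulVec_dotProduct_mulVec_inv_gram {m n : ℕ} {A : Matrix (Fin m) (Fin n) ℝ}
    (hA : A.rank = n) (y a : Fin n → ℝ) :
    (A *ᵥ y) ⬝ᵥ (A *ᵥ ((Aᵀ * A)⁻¹ *ᵥ a)) = y ⬝ᵥ a := by
  rw [Matrix.dotProduct_mulVec, Matrix.vecMul_mulVec, ← Matrix.dotProduct_mulVec,
    Matrix.mulVec_mulVec, Matrix.mul_nonsing_inv _ (gram_isUnit_of_rank hA), Matrix.one_mulVec]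

theorem invGramForm_eq {m n : ℕ} {A : Matrix (Fin m) (Fin n) ℝ} (hA : A.rank = n)
    (a : Fin n → ℝ) :
    (A *ᵥ ((Aᵀ * A)⁻¹ *ᵥ a)) ⬝ᵥ (A *ᵥ ((Aᵀ * A)⁻¹ *ᵥ a)) = invGramForm A a := by
  rw [mulVec_dotProduct_mulVec_inv_gram hA, dotProduct_comm, invGramForm]

theorem dotProduct_self_nonneg_of_real {m : ℕ} (v : Fin m → ℝ) : 0 ≤ v ⬝ᵥ v :=
  Finset.sum_nonneg fun _ _ => mul_self_nonneg _

theorem invGramForm_nonneg {m n : ℕ} {A : Matrix (Fin m) (Fin n) ℝ} (hA : A.rank = n)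
    (a : Fin n → ℝ) : 0 ≤ invGramForm A a := by
  rw [← invGramForm_eq hA]
  exact dotProduct_self_nonneg_of_real _

/-- The inverse Gram form is antitone in the Gram form. -/
theorem invGramForm_le_mul {m n : ℕ} {A B : Matrix (Fin m) (Fin n) ℝ} (hA : A.rank = n)
    (hB : B.rank = n) {c : ℝ} (hc : 0 ≤ c)
    (h : ∀ x, (A *ᵥ x) ⬝ᵥ (A *ᵥ x) ≤ c * ((B *ᵥ x) ⬝ᵥ (B *ᵥ x))) (a : Fin n → ℝ) :
    invGramForm B a ≤ c * invGramForm A a := by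
  -- Cauchy–Schwarz for `Ax` and `Ay`, where `x = (BᵀB)⁻¹a` and `y = (AᵀA)⁻¹a`: their inner product
  -- is `x ⬝ᵥ a`.
  have hcs : invGramForm B a ^ 2 ≤ c * invGramForm B a * invGramForm A a := by
    have h1 := h ((Bᵀ * B)⁻¹ *ᵥ a)
    rw [invGramForm_eq hB] at h1
    have h2 : ((A *ᵥ ((Bᵀ * B)⁻¹ *ᵥ a)) ⬝ᵥ (A *ᵥ ((Aᵀ * A)⁻¹ *ᵥ a))) ^ 2 ≤
        ((A *ᵥ ((Bᵀ * B)⁻¹ *ᵥ a)) ⬝ᵥ (A *ᵥ ((Bᵀ * B)⁻¹ *ᵥ a))) * invGramForm A a := by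
      rw [← invGramForm_eq hA]
      simp only [dotProduct, ← sq]
      exact Finset.sum_mul_sq_le_sq_mul_sq _ _ _
    rw [mulVec_dotProduct_mulVec_inv_gram hA, dotProduct_comm] at h2
    exact h2.trans (mul_le_mul_of_nonneg_right h1 (invGramForm_nonneg hA a))
  rcases (invGramForm_nonneg hB a).eq_or_lt with h0 | h0
  · rw [← h0]
    exact mul_nonneg hc (invGramForm_nonneg hA a)
  · refine le_of_mul_le_mul_left ?_ h0
    nlinarith

theorem gram_form_row_scaling_bounds {m n : ℕ} {A B : Matrix (Fin m) (Fin n) ℝ} {d : Fin m → ℝ}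
    {η : ℝ} (hη : η < 1) (hd : ∀ j, |d j| ≤ η) (hB : ∀ j, B.row j = (1 + d j) • A.row j)
    (x : Fin n → ℝ) :
    (1 - η) ^ 2 * ((A *ᵥ x) ⬝ᵥ (A *ᵥ x)) ≤ (B *ᵥ x) ⬝ᵥ (B *ᵥ x) ∧
      (B *ᵥ x) ⬝ᵥ (B *ᵥ x) ≤ (1 + η) ^ 2 * ((A *ᵥ x) ⬝ᵥ (A *ᵥ x)) := by
  have hx : ∀ j, (B *ᵥ x) j = (1 + d j) * (A *ᵥ x) j := fun j => by
    change B.row j ⬝ᵥ x = _ * (A.row j ⬝ᵥ x)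
    rw [hB, smul_dotProduct, smul_eq_mul]
  simp only [dotProduct, ← sq, hx, mul_pow, Finset.mul_sum]
  constructor <;> refine Finset.sum_le_sum fun j _ => ?_ <;>
    have h1 := abs_le.1 (hd j) <;>
    refine mul_le_mul_of_nonneg_right ?_ (sq_nonneg _) <;>
    nlinarith

theorem rank_row_scaling {m n : ℕ} {A B : Matrix (Fin m) (Fin n) ℝ} {d : Fin m → ℝ}
    {η : ℝ} (hη : η < 1) (hd : ∀ j, |d j| ≤ η) (hB : ∀ j, B.row j = (1 + d j) • A.row j) :
    B.rank = A.rank := by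
  have h : B = Matrix.diagonal (fun j => 1 + d j) * A := by
    ext j k
    rw [Matrix.diagonal_mul]
    exact congrFun (hB j) k
  rw [h]
  refine Matrix.rank_mul_eq_right_of_isUnit_det _ _ ?_
  rw [Matrix.det_diagonal, isUnit_iff_ne_zero]
  exact Finset.prod_ne_zero_iff.2 fun j _ => by linarith [(abs_le.1 (hd j)).1]

theorem leverage_ratio_bound {d s η l l' : ℝ} (hs : s ≤ η) (hη : η ≤ 1 / 2) (hd : |d| ≤ s)
    (hl : 0 < l) (hup : l' * (1 - η) ^ 2 ≤ (1 + d) ^ 2 * l)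
    (hlo : (1 + d) ^ 2 * l ≤ l' * (1 + η) ^ 2) :
    |l' - l| / l ≤ 2 * (s + η) + 40 * η ^ 2 := by
  obtain ⟨h1, h2⟩ := abs_le.1 hd
  have h0 : 0 ≤ s := (abs_nonneg d).trans hd
  obtain ⟨r, rfl⟩ : ∃ r, l' = r * l := ⟨l' / l, by field_simp⟩
  have hup' : r * (1 - η) ^ 2 ≤ (1 + d) ^ 2 := le_of_mul_le_mul_right (by linarith) hl
  have hlo' : (1 + d) ^ 2 ≤ r * (1 + η) ^ 2 := le_of_mul_le_mul_right (by linarith) hl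
  have hr : |r * l - l| / l = |r - 1| := by
    rw [show r * l - l = (r - 1) * l by ring, abs_mul, abs_of_pos hl, mul_div_cancel_right₀ _ hl.ne']
  rw [hr, abs_le]
  constructor
  · have h3 : (1 - s) ^ 2 ≤ (1 + d) ^ 2 := pow_le_pow_left₀ (by linarith) (by linarith) 2
    have h4 : (1 - 2 * s - 2 * η) * (1 + η) ^ 2 ≤ (1 - s) ^ 2 := by
      nlinarith [mul_nonneg h0 (h0.trans hs), sq_nonneg s, pow_nonneg (h0.trans hs) 3,
        mul_nonneg h0 (sq_nonneg η)]
    have h5 : 1 - 2 * s - 2 * η ≤ r :=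
      le_of_mul_le_mul_right (by linarith) (by nlinarith : 0 < (1 + η) ^ 2)
    nlinarith
  · have h3 : (1 + d) ^ 2 ≤ (1 + s) ^ 2 := pow_le_pow_left₀ (by linarith) (by linarith) 2
    have h4 : (1 + s) ^ 2 ≤ (1 + 2 * s + 2 * η + 40 * η ^ 2) * (1 - η) ^ 2 := by
      -- As `(1 - η)² ≥ 1/4`, the remainder supplies `10 η²`; the other terms leave a deficit of at
      -- most `8 η²`.
      have h5 : 40 * η ^ 2 * (1 / 4) ≤ 40 * η ^ 2 * (1 - η) ^ 2 :=
        mul_le_mul_of_nonneg_left (by nlinarith) (by positivity)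
      nlinarith [mul_nonneg h0 (h0.trans hs), sq_nonneg s, pow_nonneg (h0.trans hs) 3,
        mul_nonneg h0 (sq_nonneg η), mul_le_mul hs hs h0 (h0.trans hs),
        mul_le_mul_of_nonneg_right hs (h0.trans hs)]
    have h5 : r ≤ 1 + 2 * s + 2 * η + 40 * η ^ 2 :=
      le_of_mul_le_mul_right (by linarith) (by nlinarith : 0 < (1 - η) ^ 2)
    linarith

/-- Row-scaled perturbations `E` of `A` with scales `s` and `η = max s`. The remainder `O(η²)` has,
for fixed `A`, one constant `C` for all admissible perturbations, and in the regime `η ≤ δ` it has a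
constant `K` that, like `δ`, is independent of the matrix, its dimensions, its condition number and
its leverage scores. -/
theorem mainTheorem5 :
    ∃ K δ : ℝ, 0 < δ ∧
      ∀ (m n : ℕ) (A : Matrix (Fin m) (Fin n) ℝ), A.rank = n →
        ∃ C : ℝ, ∀ (E : Matrix (Fin m) (Fin n) ℝ) (s ζ : Fin m → ℝ) (η : ℝ),
          IsRowScaledPerturbation A E s ζ →
          IsGreatest (Set.range s) η →
          η * condTwo A < 1 →
            (A + E).rank = n ∧
            ∀ (Q Q' : Matrix (Fin m) (Fin n) ℝ) (R' : Matrix (Fin n) (Fin n) ℝ),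
              IsOrthonormalBasisOfRange A Q →
              IsThinQR (A + E) Q' R' →
              ∀ j : Fin m, 0 < rowLeverage Q j →
                |rowLeverage Q' j - rowLeverage Q j| / rowLeverage Q j
                    ≤ 2 * (s j + Real.sqrt 2 * (n : ℝ) * η) + C * η ^ 2 ∧
                (η ≤ δ →
                  |rowLeverage Q' j - rowLeverage Q j| / rowLeverage Q j
                    ≤ 2 * (s j + Real.sqrt 2 * (n : ℝ) * η) + K * η ^ 2) := by
  refine ⟨40, 1 / 2, by norm_num, fun m n A hA => ?_⟩
  -- The sum dominates `4 / ℓ_j` for each positive score, which handles `η > 1/2`; zero scores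
  -- contribute `4 / 0 = 0`.
  refine ⟨40 + ∑ j, 4 / invGramForm A (A.row j), fun E s ζ η hE hη hcond => ?_⟩
  -- For `n = 0` the condition number is `0` and does not bound `η`, but no score is positive.
  obtain rfl | hn := Nat.eq_zero_or_pos n
  · refine ⟨Nat.le_zero.1 (Matrix.rank_le_width _), fun Q Q' R' _ _ j hj => ?_⟩
    simp [rowLeverage_eq_dotProduct] at hj
  have hsη : ∀ j, s j ≤ η := fun j => hη.2 ⟨j, rfl⟩
  have hη0 : 0 ≤ η := by
    obtain ⟨j, rfl⟩ := hη.1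
    exact (hE j).1
  have hη1 : η < 1 := by
    nlinarith [one_le_condTwo hA hn]
  have hds : ∀ j, |ζ j * s j| ≤ s j := fun j => by
    rw [abs_mul, abs_of_nonneg (hE j).1]
    exact mul_le_of_le_one_left (hE j).1 (hE j).2.1
  have hd : ∀ j, |ζ j * s j| ≤ η := fun j => (hds j).trans (hsη j)
  have hB : ∀ j, (A + E).row j = (1 + ζ j * s j) • A.row j := fun j => by
    rw [add_smul, one_smul, ← (hE j).2.2]
    rfl
  have hrank : (A + E).rank = n := (rank_row_scaling hη1 hd hB).trans hA
  refine ⟨hrank, fun Q Q' R' hQ hQR j hj => ?_⟩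
  have hl := rowLeverage_eq_invGramForm hA hQ.1 hQ.eq_mul
  have hl' := rowLeverage_eq_invGramForm hrank hQR.1 hQR.2.2 j
  rw [hB, invGramForm_smul] at hl'
  have hb := gram_form_row_scaling_bounds hη1 hd hB
  have hm : 0 < (1 - η) ^ 2 := by nlinarith
  have hp : 0 < (1 + η) ^ 2 := by nlinarith
  have hup := invGramForm_le_mul hA hrank (inv_pos.2 hm).le
    (fun x => by rw [inv_mul_eq_div, le_div_iff₀ hm, mul_comm]; exact (hb x).1) (A.row j)
  have hlo := invGramForm_le_mul hrank hA hp.le (fun x => (hb x).2) (A.row j)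
  rw [inv_mul_eq_div, le_div_iff₀ hm] at hup
  rw [← hl] at hup hlo
  have hsmall : η ≤ 1 / 2 → |rowLeverage Q' j - rowLeverage Q j| / rowLeverage Q j
      ≤ 2 * (s j + Real.sqrt 2 * (n : ℝ) * η) + 40 * η ^ 2 := fun h => by
    have h1 := leverage_ratio_bound (l' := rowLeverage Q' j) (hsη j) h (hds j) hj
      (by rw [hl', mul_assoc]; exact mul_le_mul_of_nonneg_left hup (sq_nonneg _))
      (by rw [hl', mul_assoc, mul_comm _ ((1 + η) ^ 2)]
          exact mul_le_mul_of_nonneg_left hlo (sq_nonneg _))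
    have h2 : 1 ≤ Real.sqrt 2 * (n : ℝ) :=
      one_le_mul_of_one_le_of_one_le (Real.one_le_sqrt.2 (by norm_num)) (by exact_mod_cast hn)
    nlinarith
  refine ⟨?_, hsmall⟩
  have hterm : ∀ i, 0 ≤ 4 / invGramForm A (A.row i) := fun i =>
    div_nonneg (by norm_num) (invGramForm_nonneg hA _)
  rcases le_or_gt η (1 / 2) with h | h
  · refine (hsmall h).trans ?_
    have h1 := mul_nonneg (Finset.sum_nonneg fun i (_ : i ∈ Finset.univ) => hterm i) (sq_nonneg η)
    linarith
  -- Both scores lie in `[0, 1]`, and `1 ≤ 4 η²` here.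
  · have h1 : |rowLeverage Q' j - rowLeverage Q j| ≤ 1 := abs_le.2
      ⟨by linarith [rowLeverage_nonneg Q' j, rowLeverage_le_one hQ.1 j],
        by linarith [rowLeverage_nonneg Q j, rowLeverage_le_one hQR.1 j]⟩
    have h2 := Finset.single_le_sum (fun i _ => hterm i) (Finset.mem_univ j)
    rw [← hl] at h2
    calc |rowLeverage Q' j - rowLeverage Q j| / rowLeverage Q j
        ≤ 4 / rowLeverage Q j * η ^ 2 := by
          rw [div_mul_eq_mul_div]
          exact div_le_div_of_nonneg_right (by nlinarith) hj.le
      _ ≤ (40 + ∑ i, 4 / invGramForm A (A.row i)) * η ^ 2 :=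
          mul_le_mul_of_nonneg_right (by linarith) (sq_nonneg _)
      _ ≤ _ := le_add_of_nonneg_left (by have := (hE j).1; positivity)
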